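/- All graphs are finite and simple. For a graph $G$ with degree sequence $d$, the Havel–Hakimi algorithm repeatedly removes a largest term $t$ from the current sequence and subtracts $1$ from the $t$ largest remaining terms, stopping when every remaining term is $0$; the residue $R(G)$ is the number of zeroes that remain. A vertex $v$ of $G$ has the Havel–Hakimi property if $v$ has maximum degree in $G$ and no vertex adjacent to $v$ has smaller degree than any vertex other than $v$ that is not adjacent to $v$. Let $\mathcal S$ be the class of graphs $G$ such that, in every induced subgraph $H$ of $G$, every vertex of maximum degree in $H$ has the Havel–Hakimi property in $H$. Let $\alpha(G)$ denote the independence number of $G$. The Maxine heuristic starts with $G$ and, as long as the current graph contains an edge, chooses and deletes a vertex of maximum degree in the current graph; its output is the set of vertices that remain at the end. **Theorem.** If $G\in\mathcal S$, then $R(G)=\alpha(G)$. Moreover, for $G \in \mathcal S$ the Maxine heuristic always produces a maximum independent set of $G$: at least one application of it terminates with an output, and, whichever vertices of maximum degree are chosen, the resulting output is an independent set of size $\alpha(G)$. -/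

import Mathlib

/-- One round of the Havel–Hakimi algorithm: order the terms from largest to smallest, remove the
first term `t`, and subtract `1` from the next `t` terms. (For degree sequences of graphs the `t`
terms exist and are positive, so the truncated subtraction plays no role.) -/
def havelHakimiStep (d : Multiset ℕ) : Multiset ℕ :=
  match d.sort (· ≥ ·) with
  | [] => 0
  | t :: rest => ((rest.take t).map (· - 1) ++ rest.drop t : List ℕ)

theorem card_havelHakimiStep_lt (d : Multiset ℕ) (hd : ¬ ∀ t ∈ d, t = 0) :
    (havelHakimiStep d).card < d.card := by
  have hlen : (d.sort (· ≥ ·)).length = d.card := Multiset.length_sort _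
  unfold havelHakimiStep
  split
  · next h =>
    rw [h] at hlen
    exact absurd (fun t ht => by
      rw [Multiset.card_eq_zero.mp hlen.symm] at ht
      exact absurd ht (Multiset.notMem_zero t)) hd
  · next t rest h =>
    rw [h] at hlen
    simp only [List.length_cons] at hlen
    simp only [Multiset.coe_card, List.length_append, List.length_map, List.length_take,
      List.length_drop]
    omega

/-- The residue of a degree sequence `d`: run the Havel–Hakimi algorithm until all remaining terms
are zero, and count these zeroes. -/
def residue (d : Multiset ℕ) : ℕ :=
  if ∀ t ∈ d, t = 0 then d.card else residue (havelHakimiStep d)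
termination_by d.card
decreasing_by exact card_havelHakimiStep_lt d (by assumption)

namespace SimpleGraph

open Classical in
/-- The degree sequence of a finite graph, as a multiset of natural numbers. -/
noncomputable def degreeSequence {V : Type*} [Fintype V] (G : SimpleGraph V) : Multiset ℕ :=
  (Finset.univ : Finset V).val.map (fun v => G.degree v)

/-- The Havel–Hakimi residue `R(G)` of a finite graph. -/
noncomputable def havelHakimiResidue {V : Type*} [Fintype V] (G : SimpleGraph V) : ℕ :=
  residue G.degreeSequence

open Classical in
/-- `v` is a vertex of maximum degree in `G`. -/
def IsMaxDegreeVertex {V : Type*} [Fintype V] (G : SimpleGraph V) (v : V) : Prop :=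
  ∀ u : V, G.degree u ≤ G.degree v

open Classical in
/-- `v` has the Havel–Hakimi property in `G`: it has maximum degree, and no neighbor `w` of `v` has
degree smaller than that of any vertex `u ≠ v` not adjacent to `v`. -/
def HasHavelHakimiProperty {V : Type*} [Fintype V] (G : SimpleGraph V) (v : V) : Prop :=
  G.IsMaxDegreeVertex v ∧
    ∀ w u : V, G.Adj v w → u ≠ v → ¬ G.Adj v u → ¬ G.degree w < G.degree u

/-- `G` has the strong Havel–Hakimi property (that is, `G` belongs to the class `𝒮`): in every
induced subgraph of `G`, every vertex of maximum degree has the Havel–Hakimi property. -/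
def StrongHavelHakimi {V : Type*} (G : SimpleGraph V) : Prop :=
  ∀ (W : Finset V) (v : (W : Set V)),
    (G.induce (W : Set V)).IsMaxDegreeVertex v → (G.induce (W : Set V)).HasHavelHakimiProperty v

open Classical in
/-- One step of the Maxine heuristic on the current vertex set `W`: the graph `G[W]` still has an
edge, and some vertex `v` of maximum degree in `G[W]` is deleted, leaving `W'`. -/
def MaxineStep {V : Type*} (G : SimpleGraph V) (W W' : Finset V) : Prop :=
  G.induce (W : Set V) ≠ ⊥ ∧
    ∃ v : (W : Set V), (G.induce (W : Set V)).IsMaxDegreeVertex v ∧ W' = W.erase v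

/-- `I` is the result of some application of the Maxine heuristic to `G`: it is reached from the
full vertex set by finitely many deletion steps, and `G[I]` has no edges. -/
def IsMaxineOutput {V : Type*} [Fintype V] (G : SimpleGraph V) (I : Finset V) : Prop :=
  Relation.ReflTransGen G.MaxineStep Finset.univ I ∧ G.induce (I : Set V) = ⊥

end SimpleGraph

/-! For a graph in `𝒮`, deleting a maximum-degree vertex from an induced subgraph is a Havel–Hakimi
step on its degree sequence. The residue is therefore constant along any Maxine run and equals the
size of the edgeless output.

It remains to bound every independent set `J ⊆ W` by the residue of `G[W]` (`card_le_residue`).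
Delete a maximum-degree vertex outside `J` if there is one. Otherwise delete such a vertex `v ∈ J`,
after exchanging it for a neighbor whose only neighbor in `J` is `v`. Excluding two five-vertex
configurations yields that neighbor. -/

/-! ### Havel–Hakimi steps on multisets -/

theorem sort_cons_add {t : ℕ} {A B : Multiset ℕ} (hA : ∀ a ∈ A, a ≤ t) (hB : ∀ b ∈ B, b ≤ t)
    (hAB : ∀ a ∈ A, ∀ b ∈ B, b ≤ a) :
    (t ::ₘ (A + B)).sort (· ≥ ·) = t :: (A.sort (· ≥ ·) ++ B.sort (· ≥ ·)) := by
  refine List.Perm.eq_of_pairwise (le := (· ≥ ·)) (fun a b _ _ h₁ h₂ => le_antisymm h₂ h₁)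
    (Multiset.pairwise_sort _ _) ?_ ?_
  · refine List.Pairwise.cons ?_ (List.pairwise_append.mpr
      ⟨Multiset.pairwise_sort _ _, Multiset.pairwise_sort _ _, ?_⟩)
    · intro a ha
      rcases List.mem_append.mp ha with ha | ha
      · exact hA a (by simpa using ha)
      · exact hB a (by simpa using ha)
    · intro a ha b hb
      exact hAB a (by simpa using ha) b (by simpa using hb)
  · rw [← Multiset.coe_eq_coe, Multiset.sort_eq, ← Multiset.cons_coe, ← Multiset.coe_add,
      Multiset.sort_eq, Multiset.sort_eq]

/-- Ties are harmless: any block `A` of `t` terms dominating the rest can play the `t` largest. -/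
theorem havelHakimiStep_cons_add {t : ℕ} {A B : Multiset ℕ} (hcard : A.card = t)
    (hA : ∀ a ∈ A, a ≤ t) (hB : ∀ b ∈ B, b ≤ t) (hAB : ∀ a ∈ A, ∀ b ∈ B, b ≤ a) :
    havelHakimiStep (t ::ₘ (A + B)) = A.map (· - 1) + B := by
  have hlen : (A.sort (· ≥ ·)).length = t := by rw [Multiset.length_sort, hcard]
  rw [havelHakimiStep, sort_cons_add hA hB hAB]
  simp only [List.take_left' hlen, List.drop_left' hlen]
  rw [← Multiset.coe_add, ← Multiset.map_coe, Multiset.sort_eq, Multiset.sort_eq]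

theorem residue_of_forall_eq_zero {d : Multiset ℕ} (hd : ∀ t ∈ d, t = 0) :
    residue d = d.card := by
  rw [residue, if_pos hd]

theorem residue_havelHakimiStep {d : Multiset ℕ} (hd : ¬ ∀ t ∈ d, t = 0) :
    residue (havelHakimiStep d) = residue d := by
  rw [residue.eq_def d, if_neg hd]

namespace SimpleGraph

variable {V : Type*}

/-! ### Degrees inside a vertex subset -/

open Classical in
/-- The number of neighbors of `v` inside the finite set `W`. -/
noncomputable def degreeIn (G : SimpleGraph V) (W : Finset V) (v : V) : ℕ :=
  (W.filter (G.Adj v)).card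

/-- The degree sequence of the subgraph of `G` induced by `W`. -/
noncomputable def degreeSequenceIn (G : SimpleGraph V) (W : Finset V) : Multiset ℕ :=
  W.val.map (G.degreeIn W)

open Classical in
theorem degree_induce_eq_degreeIn (G : SimpleGraph V) (W : Finset V) (v : (W : Set V))
    [Fintype ((G.induce (W : Set V)).neighborSet v)] :
    (G.induce (W : Set V)).degree v = G.degreeIn W v := by
  rw [← card_neighborFinset_eq_degree, degreeIn]
  refine Finset.card_bij (fun u _ => (u : V)) ?_ ?_ ?_
  · intro u hu
    simpa using hu
  · intro a _ b _ h
    exact Subtype.ext h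
  · intro b hb
    obtain ⟨hb, hvb⟩ := Finset.mem_filter.mp hb
    exact ⟨⟨b, hb⟩, by simpa using hvb, rfl⟩

theorem degreeSequenceIn_univ [Fintype V] (G : SimpleGraph V) :
    G.degreeSequenceIn Finset.univ = G.degreeSequence := by
  classical
  unfold degreeSequenceIn degreeSequence
  refine Multiset.map_congr rfl fun v _ => ?_
  rw [degreeIn, ← card_neighborFinset_eq_degree]
  congr 1
  ext u
  simp

theorem isMaxDegreeVertex_induce_iff (G : SimpleGraph V) (W : Finset V) (v : (W : Set V)) :
    (G.induce (W : Set V)).IsMaxDegreeVertex v ↔ ∀ u ∈ W, G.degreeIn W u ≤ G.degreeIn W v := by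
  simp only [IsMaxDegreeVertex, degree_induce_eq_degreeIn]
  exact ⟨fun h u hu => h ⟨u, hu⟩, fun h u => h u u.2⟩

theorem induce_eq_bot_iff (G : SimpleGraph V) (W : Finset V) :
    G.induce (W : Set V) = ⊥ ↔ ∀ u ∈ W, ∀ v ∈ W, ¬ G.Adj u v := by
  constructor
  · intro h u hu v hv huv
    have : (G.induce (W : Set V)).Adj ⟨u, hu⟩ ⟨v, hv⟩ := huv
    rw [h] at this
    exact this
  · intro h
    ext u v
    simpa using h u u.2 v v.2

theorem StrongHavelHakimi.degreeIn_le {G : SimpleGraph V} (hG : G.StrongHavelHakimi)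
    {W : Finset V} {v w u : V} (hv : v ∈ W) (hmax : ∀ x ∈ W, G.degreeIn W x ≤ G.degreeIn W v)
    (hw : w ∈ W) (hu : u ∈ W) (hvw : G.Adj v w) (huv : u ≠ v) (hvu : ¬ G.Adj v u) :
    G.degreeIn W u ≤ G.degreeIn W w := by
  have h := (hG W ⟨v, hv⟩ ((isMaxDegreeVertex_induce_iff G W ⟨v, hv⟩).mpr hmax)).2 ⟨w, hw⟩ ⟨u, hu⟩
    hvw (fun h => huv (congrArg Subtype.val h)) hvu
  rw [degree_induce_eq_degreeIn, degree_induce_eq_degreeIn] at h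
  exact not_lt.mp h

open Classical in
theorem degreeIn_erase_of_adj {G : SimpleGraph V} {W : Finset V} {u v : V} (hv : v ∈ W)
    (huv : G.Adj u v) : G.degreeIn (W.erase v) u = G.degreeIn W u - 1 := by
  rw [degreeIn, degreeIn, Finset.filter_erase, Finset.card_erase_of_mem]
  simp [hv, huv]

open Classical in
theorem degreeIn_erase_of_not_adj {G : SimpleGraph V} {W : Finset V} {u v : V}
    (huv : ¬ G.Adj u v) : G.degreeIn (W.erase v) u = G.degreeIn W u := by
  rw [degreeIn, degreeIn, Finset.filter_erase, Finset.erase_eq_of_notMem]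
  simp [huv]

theorem degreeSequenceIn_eq_zero_iff {G : SimpleGraph V} {W : Finset V} :
    (∀ t ∈ G.degreeSequenceIn W, t = 0) ↔ ∀ u ∈ W, ∀ v ∈ W, ¬ G.Adj u v := by
  simp [degreeSequenceIn, degreeIn, Finset.filter_eq_empty_iff]

/-! ### Vertex deletion as a Havel–Hakimi step -/

open Classical in
theorem havelHakimiStep_degreeSequenceIn {G : SimpleGraph V} (hG : G.StrongHavelHakimi)
    {W : Finset V} {v : V} (hv : v ∈ W) (hmax : ∀ u ∈ W, G.degreeIn W u ≤ G.degreeIn W v) :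
    havelHakimiStep (G.degreeSequenceIn W) = G.degreeSequenceIn (W.erase v) := by
  set A := (W.erase v).val.filter (G.Adj v) with hA
  set B := (W.erase v).val.filter (fun u => ¬ G.Adj v u) with hB
  have hAB : A + B = (W.erase v).val := Multiset.filter_add_not _ _
  have memA : ∀ a ∈ A, a ∈ W ∧ G.Adj v a := fun a ha => by
    rw [hA, Multiset.mem_filter] at ha
    exact ⟨Finset.mem_of_mem_erase ha.1, ha.2⟩
  have memB : ∀ b ∈ B, b ∈ W ∧ b ≠ v ∧ ¬ G.Adj v b := fun b hb => by
    rw [hB, Multiset.mem_filter] at hb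
    exact ⟨Finset.mem_of_mem_erase hb.1, Finset.ne_of_mem_erase hb.1, hb.2⟩
  have hcons : G.degreeSequenceIn W =
      G.degreeIn W v ::ₘ (A.map (G.degreeIn W) + B.map (G.degreeIn W)) := by
    rw [← Multiset.map_add, hAB, ← Multiset.map_cons, degreeSequenceIn]
    congr 1
    rw [Finset.erase_val, Multiset.cons_erase hv]
  rw [hcons, havelHakimiStep_cons_add, degreeSequenceIn, ← hAB, Multiset.map_add, Multiset.map_map]
  · congr 1
    · exact Multiset.map_congr rfl fun a ha => (degreeIn_erase_of_adj hv (memA a ha).2.symm).symm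
    · exact Multiset.map_congr rfl fun b hb =>
        (degreeIn_erase_of_not_adj fun h => (memB b hb).2.2 h.symm).symm
  -- As `v` is not its own neighbor, erasing it leaves its neighbor count unchanged.
  · rw [Multiset.card_map, ← degreeIn_erase_of_not_adj (G.irrefl (v := v)), degreeIn,
      Finset.card_def, Finset.filter_val]
  · intro a ha
    obtain ⟨a', ha', rfl⟩ := Multiset.mem_map.mp ha
    exact hmax a' (memA a' ha').1
  · intro b hb
    obtain ⟨b', hb', rfl⟩ := Multiset.mem_map.mp hb
    exact hmax b' (memB b' hb').1
  · intro a ha b hb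
    obtain ⟨a', ha', rfl⟩ := Multiset.mem_map.mp ha
    obtain ⟨b', hb', rfl⟩ := Multiset.mem_map.mp hb
    exact hG.degreeIn_le hv hmax (memA a' ha').1 (memB b' hb').1 (memA a' ha').2
      (memB b' hb').2.1 (memB b' hb').2.2

open Classical in
theorem residue_degreeSequenceIn_erase {G : SimpleGraph V} (hG : G.StrongHavelHakimi)
    {W : Finset V} {v : V} (hv : v ∈ W) (hmax : ∀ u ∈ W, G.degreeIn W u ≤ G.degreeIn W v)
    (hedge : ¬ ∀ u ∈ W, ∀ v ∈ W, ¬ G.Adj u v) :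
    residue (G.degreeSequenceIn (W.erase v)) = residue (G.degreeSequenceIn W) := by
  rw [← havelHakimiStep_degreeSequenceIn hG hv hmax]
  exact residue_havelHakimiStep fun h => hedge (degreeSequenceIn_eq_zero_iff.mp h)

theorem residue_degreeSequenceIn_of_edgeless {G : SimpleGraph V} {W : Finset V}
    (h : ∀ u ∈ W, ∀ v ∈ W, ¬ G.Adj u v) : residue (G.degreeSequenceIn W) = W.card := by
  rw [residue_of_forall_eq_zero (degreeSequenceIn_eq_zero_iff.mpr h), degreeSequenceIn,
    Multiset.card_map, Finset.card_def]

/-! ### Forbidden configurations and the exchange -/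

open Classical in
/-- A graph in `𝒮` contains no induced path on five vertices `a - b - c - d - e`. -/
theorem StrongHavelHakimi.not_induced_path {G : SimpleGraph V} (hG : G.StrongHavelHakimi)
    {a b c d e : V} (hab : G.Adj a b) (hbc : G.Adj b c) (hcd : G.Adj c d) (hde : G.Adj d e)
    (hac : ¬ G.Adj a c) (had : ¬ G.Adj a d) (hae : ¬ G.Adj a e) (hbd : ¬ G.Adj b d)
    (hbe : ¬ G.Adj b e) (hce : ¬ G.Adj c e) : False := by
  have nac : a ≠ c := by rintro rfl; exact had hcd
  have nad : a ≠ d := by rintro rfl; exact hac hcd.symm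
  have nae : a ≠ e := by rintro rfl; exact hbe hab.symm
  have nbd : b ≠ d := by rintro rfl; exact had hab
  have nbe : b ≠ e := by rintro rfl; exact hae hab
  have nce : c ≠ e := by rintro rfl; exact hbe hbc
  have nab := hab.ne
  have nbc := hbc.ne
  have ncd := hcd.ne
  have nde := hde.ne
  have da : G.degreeIn {a, b, c, d, e} a = 1 := by
    simp [degreeIn, Finset.filter_insert, Finset.filter_singleton, *]
  have db : G.degreeIn {a, b, c, d, e} b = 2 := by
    simp [degreeIn, Finset.filter_insert, Finset.filter_singleton, hab.symm, *]
  have dc : G.degreeIn {a, b, c, d, e} c = 2 := by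
    simp [degreeIn, Finset.filter_insert, Finset.filter_singleton, hbc.symm, G.adj_comm c a, *]
  have dd : G.degreeIn {a, b, c, d, e} d = 2 := by
    simp [degreeIn, Finset.filter_insert, Finset.filter_singleton, hcd.symm, G.adj_comm d a,
      G.adj_comm d b, *]
  have de : G.degreeIn {a, b, c, d, e} e = 1 := by
    simp [degreeIn, Finset.filter_insert, Finset.filter_singleton, hde.symm, G.adj_comm e a,
      G.adj_comm e b, G.adj_comm e c, *]
  -- The maximum-degree vertex `b` has a neighbor `a` of degree 1 but a nonneighbor `d` of degree 2.
  have := hG.degreeIn_le (W := {a, b, c, d, e}) (v := b) (w := a) (u := d) (by simp)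
    (by simp [da, db, dc, dd, de]) (by simp) (by simp) hab.symm nbd.symm hbd
  omega

open Classical in
/-- In a graph in `𝒮`, among the common neighbors of two nonadjacent vertices each one has at most
one nonneighbor. -/
theorem StrongHavelHakimi.eq_of_common_neighbors {G : SimpleGraph V} (hG : G.StrongHavelHakimi)
    {u v w x y : V} (huv : u ≠ v) (nuv : ¬ G.Adj u v)
    (huw : G.Adj u w) (hux : G.Adj u x) (huy : G.Adj u y)
    (hvw : G.Adj v w) (hvx : G.Adj v x) (hvy : G.Adj v y)
    (hwx : w ≠ x) (nwx : ¬ G.Adj w x) (hwy : w ≠ y) (nwy : ¬ G.Adj w y) : x = y := by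
  by_contra hxy
  have nuw := huw.ne
  have nux := hux.ne
  have nuy := huy.ne
  have nvw := hvw.ne
  have nvx := hvx.ne
  have nvy := hvy.ne
  have du : G.degreeIn {u, v, w, x, y} u = 3 := by
    simp [degreeIn, Finset.filter_insert, Finset.filter_singleton, *]
  have dv : G.degreeIn {u, v, w, x, y} v = 3 := by
    simp [degreeIn, Finset.filter_insert, Finset.filter_singleton, G.adj_comm v u, *]
  have dw : G.degreeIn {u, v, w, x, y} w = 2 := by
    simp [degreeIn, Finset.filter_insert, Finset.filter_singleton, huw.symm, hvw.symm, *]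
  -- Only a bound is available, since `x` and `y` may or may not be adjacent.
  have dx : G.degreeIn {u, v, w, x, y} x ≤ 3 := by
    refine (Finset.card_le_card (t := {u, v, y}) ?_).trans Finset.card_le_three
    intro z hz
    simp only [Finset.mem_filter, Finset.mem_insert, Finset.mem_singleton] at hz ⊢
    rcases hz with ⟨rfl | rfl | rfl | rfl | rfl, h⟩
    · simp
    · simp
    · exact absurd h.symm nwx
    · exact absurd h (G.irrefl)
    · simp
  have dy : G.degreeIn {u, v, w, x, y} y ≤ 3 := by
    refine (Finset.card_le_card (t := {u, v, x}) ?_).trans Finset.card_le_three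
    intro z hz
    simp only [Finset.mem_filter, Finset.mem_insert, Finset.mem_singleton] at hz ⊢
    rcases hz with ⟨rfl | rfl | rfl | rfl | rfl, h⟩
    · simp
    · simp
    · exact absurd h.symm nwy
    · simp
    · exact absurd h (G.irrefl)
  have := hG.degreeIn_le (W := {u, v, w, x, y}) (v := v) (w := w) (u := u) (by simp)
    (by simp [du, dv, dw, dx, dy]) (by simp) (by simp) hvw huv (fun h => nuv h.symm)
  omega

open Classical in
/-- If `v` lies in the independent set `J ⊆ W` and all neighbors of `v` in `W` have smaller degree
than `v`, then some neighbor of `v` can replace it in `J`. -/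
theorem StrongHavelHakimi.exists_private_neighbor {G : SimpleGraph V} (hG : G.StrongHavelHakimi)
    {W J : Finset V} {v : V} (hJW : J ⊆ W) (hJ : ∀ a ∈ J, ∀ b ∈ J, ¬ G.Adj a b) (hv : v ∈ J)
    (hpos : 0 < G.degreeIn W v)
    (hlt : ∀ w ∈ W, G.Adj v w → G.degreeIn W w < G.degreeIn W v) :
    ∃ w ∈ W, G.Adj v w ∧ ∀ u ∈ J, G.Adj w u → u = v := by
  by_contra! hcon
  obtain ⟨w, hw⟩ := Finset.card_pos.mp hpos
  obtain ⟨hwW, hvw⟩ := Finset.mem_filter.mp hw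
  set U := (J.erase v).filter (G.Adj w) with hU
  set C := (W.filter (G.Adj v)).filter (fun x => x ≠ w ∧ ¬ G.Adj w x) with hC
  -- The vertex `v`, the set `U` and the common neighbors of `v` and `w` are disjoint parts of the
  -- neighborhood of `w`, whose degree is below that of `v`.
  have hcard : U.card < C.card := by
    have hsub : insert v (U ∪ ((W.filter (G.Adj v)).erase w \ C)) ⊆ W.filter (G.Adj w) := by
      intro z hz
      simp only [hU, hC, Finset.mem_insert, Finset.mem_union, Finset.mem_sdiff, Finset.mem_erase,
        Finset.mem_filter] at hz ⊢
      rcases hz with rfl | ⟨⟨_, hz⟩, hwz⟩ | ⟨⟨hzw, hz, hvz⟩, h⟩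
      · exact ⟨hJW hv, hvw.symm⟩
      · exact ⟨hJW hz, hwz⟩
      · exact ⟨hz, by tauto⟩
    have h₁ := Finset.card_le_card hsub
    rw [Finset.card_insert_of_notMem (by simp [hU]), Finset.card_union_of_disjoint] at h₁
    · have h₂ := Finset.le_card_sdiff C ((W.filter (G.Adj v)).erase w)
      rw [Finset.card_erase_of_mem hw] at h₂
      have h₃ := hlt w hwW hvw
      unfold degreeIn at h₃ hpos
      omega
    · rw [Finset.disjoint_left]
      intro z hz hz'
      simp only [hU, Finset.mem_sdiff, Finset.mem_erase, Finset.mem_filter] at hz hz'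
      exact hJ v hv z hz.1.2 hz'.1.2.2
  -- Otherwise `u - w - v - x - u'` is an induced path, with `u` and `u'` further `J`-neighbors of
  -- `w` and `x`.
  have hcommon : ∀ x ∈ C, ∃ u ∈ U, G.Adj x u := by
    intro x hx
    by_contra! hxU
    simp only [hC, Finset.mem_filter] at hx
    obtain ⟨⟨hxW, hvx⟩, hxw, hwx⟩ := hx
    obtain ⟨u, hu, hwu, huv⟩ := hcon w hwW hvw
    obtain ⟨u', hu', hxu', huv'⟩ := hcon x hxW hvx
    have hxu : ¬ G.Adj x u := hxU u (by simp [hU, hu, hwu, huv])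
    have hwu' : ¬ G.Adj w u' := fun h => hxU u' (by simp [hU, hu', h, huv']) hxu'
    exact hG.not_induced_path hwu.symm hvw.symm hvx hxu' (hJ u hu v hv) (fun h => hxu h.symm)
      (hJ u hu u' hu') hwx hwu' (hJ v hv u' hu')
  choose! f hfU hf using hcommon
  -- By pigeonhole some `u ∈ U` serves both `x` and `y`, so `u` and `v` share the neighbors `w`,
  -- `x`, `y`, with `w` missing two of them.
  obtain ⟨x, hx, y, hy, hxy, hfxy⟩ := Finset.exists_ne_map_eq_of_card_lt_of_maps_to hcard hfU
  have hfx := hfU x hx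
  have hxf := hf x hx
  have hyf := hf y hy
  rw [← hfxy] at hyf
  simp only [hU, hC, Finset.mem_filter, Finset.mem_erase] at hfx hx hy
  exact hxy (hG.eq_of_common_neighbors hfx.1.1 (hJ _ hfx.1.2 v hv) hfx.2.symm hxf.symm hyf.symm
    hvw hx.1.2 hy.1.2 hx.2.1.symm hx.2.2 hy.2.1.symm hy.2.2)

/-! ### Independent sets are bounded by the residue -/

open Classical in
theorem exists_max_degreeIn (G : SimpleGraph V) {W : Finset V}
    (hedge : ¬ ∀ u ∈ W, ∀ v ∈ W, ¬ G.Adj u v) :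
    ∃ v ∈ W, (∀ u ∈ W, G.degreeIn W u ≤ G.degreeIn W v) ∧ 0 < G.degreeIn W v := by
  push Not at hedge
  obtain ⟨a, ha, b, hb, hab⟩ := hedge
  obtain ⟨v, hv, hmax⟩ := W.exists_max_image (G.degreeIn W) ⟨a, ha⟩
  refine ⟨v, hv, hmax, lt_of_lt_of_le ?_ (hmax a ha)⟩
  exact Finset.card_pos.mpr ⟨b, Finset.mem_filter.mpr ⟨hb, hab⟩⟩

open Classical in
theorem StrongHavelHakimi.card_le_residue {G : SimpleGraph V} (hG : G.StrongHavelHakimi)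
    (W J : Finset V) (hJW : J ⊆ W) (hJ : ∀ a ∈ J, ∀ b ∈ J, ¬ G.Adj a b) :
    J.card ≤ residue (G.degreeSequenceIn W) := by
  induction W using Finset.strongInduction generalizing J with
  | H W ih =>
    by_cases hedge : ∀ u ∈ W, ∀ v ∈ W, ¬ G.Adj u v
    · rw [residue_degreeSequenceIn_of_edgeless hedge]
      exact Finset.card_le_card hJW
    obtain ⟨v, hv, hmax, hpos⟩ := G.exists_max_degreeIn hedge
    by_cases hout : ∃ x ∈ W, x ∉ J ∧ G.degreeIn W x = G.degreeIn W v
    · obtain ⟨x, hx, hxJ, hdx⟩ := hout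
      rw [← residue_degreeSequenceIn_erase hG hx (hdx ▸ hmax) hedge]
      exact ih _ (Finset.erase_ssubset hx) J (Finset.subset_erase.mpr ⟨hJW, hxJ⟩) hJ
    push Not at hout
    have hvJ : v ∈ J := by
      by_contra h
      exact hout v hv h rfl
    -- All maximum-degree vertices lie in `J`, so every neighbor of `v` has strictly smaller degree,
    -- as the exchange requires.
    obtain ⟨w, hw, hvw, hwJ⟩ := hG.exists_private_neighbor hJW hJ hvJ hpos fun w hw hvw =>
      lt_of_le_of_ne (hmax w hw) (hout w hw fun h => hJ v hvJ w h hvw)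
    have hwJ' : w ∉ J.erase v := fun h => hJ v hvJ w (Finset.mem_of_mem_erase h) hvw
    rw [← residue_degreeSequenceIn_erase hG hv hmax hedge,
      ← Finset.card_erase_add_one hvJ, ← Finset.card_insert_of_notMem hwJ']
    refine ih _ (Finset.erase_ssubset hv) _ ?_ ?_
    · intro z hz
      rcases Finset.mem_insert.mp hz with rfl | hz
      · exact Finset.mem_erase.mpr ⟨hvw.ne', hw⟩
      · exact Finset.erase_subset_erase v hJW hz
    · intro a ha b hb hab
      rcases Finset.mem_insert.mp ha with rfl | ha' <;>
        rcases Finset.mem_insert.mp hb with rfl | hb'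
      · exact G.irrefl hab
      · exact Finset.ne_of_mem_erase hb' (hwJ b (Finset.mem_of_mem_erase hb') hab)
      · exact Finset.ne_of_mem_erase ha' (hwJ a (Finset.mem_of_mem_erase ha') hab.symm)
      · exact hJ a (Finset.mem_of_mem_erase ha') b (Finset.mem_of_mem_erase hb') hab

/-! ### Runs of the Maxine heuristic -/

theorem MaxineStep.residue_eq {G : SimpleGraph V} (hG : G.StrongHavelHakimi) {W W' : Finset V}
    (h : G.MaxineStep W W') :
    residue (G.degreeSequenceIn W') = residue (G.degreeSequenceIn W) := by
  obtain ⟨hedge, v, hmax, rfl⟩ := h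
  exact residue_degreeSequenceIn_erase hG v.2 ((isMaxDegreeVertex_induce_iff G W v).mp hmax)
    fun h => hedge ((induce_eq_bot_iff G W).mpr h)

theorem residue_eq_of_reflTransGen_maxineStep {G : SimpleGraph V} (hG : G.StrongHavelHakimi)
    {W W' : Finset V} (h : Relation.ReflTransGen G.MaxineStep W W') :
    residue (G.degreeSequenceIn W') = residue (G.degreeSequenceIn W) := by
  induction h with
  | refl => rfl
  | tail _ hstep ih => rw [hstep.residue_eq hG, ih]

open Classical in
theorem exists_reflTransGen_maxineStep (G : SimpleGraph V) (W : Finset V) :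
    ∃ I : Finset V, Relation.ReflTransGen G.MaxineStep W I ∧ G.induce (I : Set V) = ⊥ := by
  induction W using Finset.strongInduction with
  | H W ih =>
    by_cases hbot : G.induce (W : Set V) = ⊥
    · exact ⟨W, .refl, hbot⟩
    obtain ⟨v, hv, hmax, -⟩ :=
      G.exists_max_degreeIn fun h => hbot ((induce_eq_bot_iff G W).mpr h)
    obtain ⟨I, hI, hI'⟩ := ih _ (Finset.erase_ssubset hv)
    exact ⟨I, .head ⟨hbot, ⟨v, hv⟩, (isMaxDegreeVertex_induce_iff G W ⟨v, hv⟩).mpr hmax, rfl⟩ hI,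
      hI'⟩

theorem StrongHavelHakimi.card_of_isMaxineOutput [Fintype V] {G : SimpleGraph V}
    (hG : G.StrongHavelHakimi) {I : Finset V} (hI : G.IsMaxineOutput I) :
    I.card = G.havelHakimiResidue := by
  rw [havelHakimiResidue, ← degreeSequenceIn_univ, ← residue_eq_of_reflTransGen_maxineStep hG hI.1,
    residue_degreeSequenceIn_of_edgeless ((induce_eq_bot_iff G I).mp hI.2)]

theorem StrongHavelHakimi.isMaximumIndepSet_of_isMaxineOutput [Fintype V] {G : SimpleGraph V}
    (hG : G.StrongHavelHakimi) {I : Finset V} (hI : G.IsMaxineOutput I) :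
    G.IsMaximumIndepSet I := by
  refine ⟨fun a ha b hb _ => (induce_eq_bot_iff G I).mp hI.2 a ha b hb, fun J hJ => ?_⟩
  rw [hG.card_of_isMaxineOutput hI, havelHakimiResidue, ← degreeSequenceIn_univ]
  exact hG.card_le_residue Finset.univ J (Finset.subset_univ J)
    fun a ha b hb hab => hJ ha hb hab.ne hab

end SimpleGraph

theorem mainTheorem2 {V : Type*} [Fintype V] (G : SimpleGraph V) (hG : G.StrongHavelHakimi) :
    G.havelHakimiResidue = G.indepNum ∧
      (∃ I : Finset V, G.IsMaxineOutput I) ∧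
      ∀ I : Finset V, G.IsMaxineOutput I → G.IsMaximumIndepSet I := by
  obtain ⟨I, hI⟩ := G.exists_reflTransGen_maxineStep Finset.univ
  refine ⟨?_, ⟨I, hI⟩, fun J hJ => hG.isMaximumIndepSet_of_isMaxineOutput hJ⟩
  rw [← hG.card_of_isMaxineOutput hI]
  exact G.maximumIndepSet_card_eq_indepNum I (hG.isMaximumIndepSet_of_isMaxineOutput hI)
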